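/- Let $\Omega\subset\mathbb C$ be a bounded domain and let $K_1,K_2:\Omega\times\Omega\to\mathbb C$ be non-negative definite kernels that are sesqui-analytic (holomorphic in $z$ and anti-holomorphic in $w$, i.e. $(z,u)\mapsto K_i(z,\bar u)$ is holomorphic on $\Omega\times\Omega^*$, $\Omega^*=\{u:\bar u\in\Omega\}$). Let $(\mathcal H,K_i)$ be the reproducing kernel Hilbert space of functions on $\Omega$ with kernel $K_i$, and assume that multiplication by the coordinate function is bounded on $(\mathcal H,K_1)$ and on $(\mathcal H,K_2)$. Regard the vectors of the Hilbert space tensor product $(\mathcal H,K_1)\otimes(\mathcal H,K_2)$ as functions on $\Omega\times\Omega$, with $(g\otimes h)(z,\zeta)=g(z)h(\zeta)$. For an integer $n\ge 0$ let $$\mathcal A_n=\Big\{f\in(\mathcal H,K_1)\otimes(\mathcal H,K_2):\ \big(\tfrac{\partial}{\partial\zeta}\big)^i f(z,\zeta)\big|_{\zeta=z}=0\ \text{ for all } z\in\Omega,\ 0\le i\le n\Big\},$$ and let $J_n(K_1,K_2)|_{\mathrm{res}\,\Delta}$ be the $(n+1)\times(n+1)$ matrix valued kernel $$J_n(K_1,K_2)|_{\mathrm{res}\,\Delta}(z,w)=\Big(K_1(z,w)\big(\tfrac{\partial}{\partial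 z}\big)^i\big(\tfrac{\partial}{\partial\bar w}\big)^jK_2(z,w)\Big)_{i,j=0}^n .$$ For holomorphic $\psi:\Omega\to\mathbb C$ let $(\mathcal J_n\psi)(z)$ be the lower triangular $(n+1)\times(n+1)$ matrix with entries $\binom ij\psi^{(i-j)}(z)$, $0\le j\le i\le n$. For holomorphic $\varphi:\Omega\to\Omega$ let $(\mathcal B_n\varphi)(z)$ be the lower triangular $(n+1)\times(n+1)$ matrix whose $(0,0)$ entry is $1$, whose other entries in row $0$ and column $0$ vanish, and whose $(i,j)$ entry for $1\le j\le i\le n$ is $B_{i,j}(\varphi^{(1)}(z),\dots,\varphi^{(i-j+1)}(z))$, where $B_{i,j}$ are the partial exponential Bell polynomials. For a scalar or matrix valued function $\Psi$ on $\Omega$ write $(M_\Psi C_\varphi f)(z)=\Psi(z)f(\varphi(z))$. Let $\psi_1,\psi_2:\Omega\to\mathbb C$ and $\varphi:\Omega\to\Omega$ be holomorphic, and suppose that $M_{\psi_1}C_\varphi$ is bounded on $(\mathcal H,K_1)$ and $M_{\psi_2}C_\varphi$ is bounded on $(\mathcal H,K_2)$. Then, for every $n\ge0$, $J_n(K_1,K_2)|_{\mathrm{res}\,\Delta}$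 is a non-negative definite kernel, and on the reproducing kernel Hilbert space $(\mathcal H,J_n(K_1,K_2)|_{\mathrm{res}\,\Delta})$ of $\mathbb C^{n+1}$-valued functions with this kernel the operator $M_{\psi_1(\mathcal J_n\psi_2)(\mathcal B_n\varphi)}C_\varphi$ is bounded and is unitarily equivalent to the compression $$P_{\mathcal A_n^\perp}\big(M_{\psi_1}C_\varphi\otimes M_{\psi_2}C_\varphi\big)\big|_{\mathcal A_n^\perp}.$$ In particular $$\big\|M_{\psi_1(\mathcal J_n\psi_2)(\mathcal B_n\varphi)}C_\varphi\big\|\le\|M_{\psi_1}C_\varphi\|\,\|M_{\psi_2}C_\varphi\| .$$ -/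

import Mathlib

open scoped TensorProduct InnerProductSpace ComplexConjugate ComplexOrder
open UniformSpace (Completion)

noncomputable section

/-! ### Hilbert space tensor products -/

section HilbertTensor

variable {H₁ H₂ : Type*}
  [NormedAddCommGroup H₁] [InnerProductSpace ℂ H₁]
  [NormedAddCommGroup H₂] [InnerProductSpace ℂ H₂]

/-- The Hilbert space tensor product: the completion of the algebraic tensor product for the
inner product `⟪a ⊗ b, c ⊗ d⟫ = ⟪a, c⟫ * ⟪b, d⟫`. -/
abbrev HilbertTensor (H₁ H₂ : Type*)
    [NormedAddCommGroup H₁] [InnerProductSpace ℂ H₁]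
    [NormedAddCommGroup H₂] [InnerProductSpace ℂ H₂] : Type _ :=
  Completion (H₁ ⊗[ℂ] H₂)

/-- The elementary tensor `f ⊗ g` in the Hilbert space tensor product. -/
def HilbertTensor.tmul (f : H₁) (g : H₂) : HilbertTensor H₁ H₂ :=
  ((f ⊗ₜ[ℂ] g : H₁ ⊗[ℂ] H₂) : Completion (H₁ ⊗[ℂ] H₂))

theorem HilbertTensor.inner_tmul (a c : H₁) (b d : H₂) :
    ⟪HilbertTensor.tmul a b, HilbertTensor.tmul c d⟫_ℂ = ⟪a, c⟫_ℂ * ⟪b, d⟫_ℂ := by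
  simp [HilbertTensor.tmul]

/-- The tensor product `T₁ ⊗ T₂` of two bounded operators, as a bounded operator on the Hilbert
space tensor product: the continuous extension of the algebraic tensor product. -/
def HilbertTensor.map (T₁ : H₁ →L[ℂ] H₁) (T₂ : H₂ →L[ℂ] H₂) :
    HilbertTensor H₁ H₂ →L[ℂ] HilbertTensor H₁ H₂ :=
  ((Completion.toComplL (𝕜 := ℂ) (E := H₁ ⊗[ℂ] H₂)) ∘L (TensorProduct.mapL T₁ T₂)).extend
    (Completion.toComplL (𝕜 := ℂ) (E := H₁ ⊗[ℂ] H₂))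

theorem HilbertTensor.map_tmul (T₁ : H₁ →L[ℂ] H₁) (T₂ : H₂ →L[ℂ] H₂) (f : H₁) (g : H₂) :
    HilbertTensor.map T₁ T₂ (HilbertTensor.tmul f g) = HilbertTensor.tmul (T₁ f) (T₂ g) := by
  have h := ContinuousLinearMap.extend_eq
    ((Completion.toComplL (𝕜 := ℂ) (E := H₁ ⊗[ℂ] H₂)) ∘L (TensorProduct.mapL T₁ T₂))
    (e := Completion.toComplL (𝕜 := ℂ) (E := H₁ ⊗[ℂ] H₂))
    Completion.denseRange_coe (Completion.isUniformInducing_coe _) (f ⊗ₜ[ℂ] g)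
  exact h

variable {X Y : Type*} [CompleteSpace H₁] [CompleteSpace H₂]
  [RKHS ℂ H₁ X ℂ] [RKHS ℂ H₂ Y ℂ]

/-- Vectors of `H₁ ⊗ H₂` are functions on `X × Y`: `f (x, y) = ⟪k_x ⊗ k_y, f⟫`, where `k_x`, `k_y`
are the kernel functions. On elementary tensors, `(g ⊗ h) (x, y) = g x * h y`
(`HilbertTensor.tmul_apply`). -/
instance HilbertTensor.instRKHS : RKHS ℂ (HilbertTensor H₁ H₂) (X × Y) ℂ where
  coeCLM := ContinuousLinearMap.pi fun p ↦
    innerSL ℂ (HilbertTensor.tmul (RKHS.kerFun H₁ p.1 1) (RKHS.kerFun H₂ p.2 1))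
  coeCLM_injective := by
    refine (injective_iff_map_eq_zero _).mpr fun f h ↦ ?_
    have h0 : ∀ x y, ⟪HilbertTensor.tmul (RKHS.kerFun H₁ x 1) (RKHS.kerFun H₂ y 1), f⟫_ℂ = 0 :=
      fun x y ↦ congrFun h (x, y)
    -- the bounded bilinear map `(a, b) ↦ a ⊗ b`
    let L : H₁ →L[ℂ] H₂ →L[ℂ] HilbertTensor H₁ H₂ :=
      (ContinuousLinearMap.compL ℂ H₂ (H₁ ⊗[ℂ] H₂) (HilbertTensor H₁ H₂)
        Completion.toComplL) ∘L (TensorProduct.mkL ℂ H₁ H₂)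
    have hL : ∀ a b, L a b = HilbertTensor.tmul a b := fun a b ↦ rfl
    have h1 : ∀ (a : H₁) (y : Y), ⟪f, L a (RKHS.kerFun H₂ y 1)⟫_ℂ = 0 := by
      intro a y
      let φ : H₁ →L[ℂ] ℂ := (innerSL ℂ f) ∘L (L.flip (RKHS.kerFun H₂ y 1))
      have hφ : (⊤ : Submodule ℂ H₁) ≤ φ.ker := by
        rw [← RKHS.kerFun_dense H₁]
        refine Submodule.topologicalClosure_minimal _ (Submodule.span_le.mpr ?_) φ.isClosed_ker
        rintro _ ⟨x, v, rfl⟩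
        have hv : RKHS.kerFun H₁ x v = v • RKHS.kerFun H₁ x 1 := by
          rw [← map_smul, smul_eq_mul, mul_one]
        have : φ (RKHS.kerFun H₁ x 1) = 0 := by
          change ⟪f, HilbertTensor.tmul _ _⟫_ℂ = 0
          rw [← inner_conj_symm, h0, map_zero]
        change φ _ = 0
        rw [hv, map_smul, this, smul_zero]
      exact hφ (Submodule.mem_top (x := a))
    have h2 : ∀ (a : H₁) (b : H₂), ⟪f, L a b⟫_ℂ = 0 := by
      intro a b
      let φ : H₂ →L[ℂ] ℂ := (innerSL ℂ f) ∘L (L a)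
      have hφ : (⊤ : Submodule ℂ H₂) ≤ φ.ker := by
        rw [← RKHS.kerFun_dense H₂]
        refine Submodule.topologicalClosure_minimal _ (Submodule.span_le.mpr ?_) φ.isClosed_ker
        rintro _ ⟨y, v, rfl⟩
        have hv : RKHS.kerFun H₂ y v = v • RKHS.kerFun H₂ y 1 := by
          rw [← map_smul, smul_eq_mul, mul_one]
        have : φ (RKHS.kerFun H₂ y 1) = 0 := h1 a y
        change φ _ = 0
        rw [hv, map_smul, this, smul_zero]
      exact hφ (Submodule.mem_top (x := b))
    refine Completion.denseRange_coe.eq_zero_of_inner_left ℂ fun t ↦ ?_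
    induction t using TensorProduct.induction_on with
    | zero => rw [Completion.coe_zero, inner_zero_right]
    | tmul a b => exact h2 a b
    | add s t hs ht => rw [Completion.coe_add, inner_add_right, hs, ht, add_zero]

theorem HilbertTensor.apply_eq (f : HilbertTensor H₁ H₂) (x : X) (y : Y) :
    f (x, y) = ⟪HilbertTensor.tmul (RKHS.kerFun H₁ x 1) (RKHS.kerFun H₂ y 1), f⟫_ℂ := rfl

theorem HilbertTensor.tmul_apply (g : H₁) (h : H₂) (x : X) (y : Y) :
    (HilbertTensor.tmul g h : HilbertTensor H₁ H₂) (x, y) = g x * h y := by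
  rw [HilbertTensor.apply_eq, HilbertTensor.inner_tmul]
  simp

end HilbertTensor

/-! ### Operators -/

/-- `T` is the weighted composition operator `M_Ψ C_φ : f ↦ Ψ · (f ∘ φ)` on the reproducing kernel
Hilbert space `H` of `V`-valued functions on `X`. As vectors of `H` are determined by their values,
`T` is unique; "`M_Ψ C_φ` is bounded on `H`" means that such a bounded operator `T` exists. -/
def IsWeightedComposition {H X V : Type*} [NormedAddCommGroup V] [InnerProductSpace ℂ V]
    [NormedAddCommGroup H] [InnerProductSpace ℂ H] [RKHS ℂ H X V]
    (Ψ : X → V →L[ℂ] V) (φ : X → X) (T : H →L[ℂ] H) : Prop :=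
  ∀ (f : H) (x : X), T f x = Ψ x (f (φ x))

/-- The compression `P_S T|_S` of `T` to a subspace `S`, as an operator on `S`. -/
def compression {H : Type*} [NormedAddCommGroup H] [InnerProductSpace ℂ H]
    (S : Submodule ℂ H) [S.HasOrthogonalProjection] (T : H →L[ℂ] H) : S →L[ℂ] S :=
  S.orthogonalProjectionOnto ∘L T ∘L S.subtypeL

/-- Unitary equivalence of bounded operators on (possibly different) Hilbert spaces. -/
def UnitarilyEquivalent {E F : Type*} [NormedAddCommGroup E] [InnerProductSpace ℂ E]
    [NormedAddCommGroup F] [InnerProductSpace ℂ F] (A : E →L[ℂ] E) (B : F →L[ℂ] F) : Prop :=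
  ∃ U : E ≃ₗᵢ[ℂ] F, ∀ x, U (A x) = B (U x)

/-! ### Kernels and the jet construction

Functions on `Ω` (kernels, weights, symbols) are given by functions on `ℂ` of which only the values
on the open set `Ω` matter. -/

/-- `K(z, w)` is holomorphic in `z ∈ Ω` and anti-holomorphic in `w ∈ Ω`, that is,
`(z, u) ↦ K(z, ū)` is holomorphic on `Ω × Ω*` where `Ω* = {u : ū ∈ Ω}`. -/
def SesquiAnalyticOn (Ω : Set ℂ) (K : ℂ → ℂ → ℂ) : Prop :=
  DifferentiableOn ℂ (fun p : ℂ × ℂ ↦ K p.1 (conj p.2)) {p | p.1 ∈ Ω ∧ conj p.2 ∈ Ω}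

/-- A scalar kernel on `Ω`, with values regarded as operators on `ℂ`. -/
def scalarKernel (Ω : Set ℂ) (K : ℂ → ℂ → ℂ) : Matrix Ω Ω (ℂ →L[ℂ] ℂ) :=
  Matrix.of fun z w ↦ K z w • ContinuousLinearMap.id ℂ ℂ

/-- A matrix valued kernel on `Ω`, with values regarded as operators on `ℂ^m`. -/
def matrixKernel {m : ℕ} (Ω : Set ℂ) (K : ℂ → ℂ → Matrix (Fin m) (Fin m) ℂ) :
    Matrix Ω Ω (EuclideanSpace ℂ (Fin m) →L[ℂ] EuclideanSpace ℂ (Fin m)) :=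
  Matrix.of fun z w ↦ Matrix.toEuclideanCLM (𝕜 := ℂ) (K z w)

/-- `(∂/∂z)^i (∂/∂w̄)^j K (z, w)` for a sesqui-analytic `K`. Since `K(z, ·)` is anti-holomorphic,
`(∂/∂w̄)^j` is the `j`-th complex derivative of `u ↦ K(z, ū)` at `u = w̄`. -/
def mixedDeriv (K : ℂ → ℂ → ℂ) (i j : ℕ) (z w : ℂ) : ℂ :=
  iteratedDeriv i (fun z' ↦ iteratedDeriv j (fun u ↦ K z' (conj u)) (conj w)) z

/-- The jet kernel `J_n(K₁, K₂)|_{res Δ}`. -/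
def jetKernel (n : ℕ) (K₁ K₂ : ℂ → ℂ → ℂ) (z w : ℂ) : Matrix (Fin (n + 1)) (Fin (n + 1)) ℂ :=
  Matrix.of fun i j ↦ K₁ z w * mixedDeriv K₂ i j z w

/-- The matrix `(𝒥_n ψ)(z)`, with entries `(i choose j) ψ^(i - j)(z)` for `j ≤ i`. -/
def jetMatrix (n : ℕ) (ψ : ℂ → ℂ) (z : ℂ) : Matrix (Fin (n + 1)) (Fin (n + 1)) ℂ :=
  Matrix.of fun i j ↦
    if j ≤ i then (Nat.choose i j : ℂ) * iteratedDeriv ((i : ℕ) - (j : ℕ)) ψ z else 0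

/-- The partial exponential Bell polynomial `B_{i,j}(x₁, …, x_{i-j+1})`: the sum over all partitions
of an `i`-element set into `j` blocks of the product of `x_{|b|}` over the blocks `b`.
(`OrderedFinpartition i` is the type of set partitions of `Fin i`; the blocks are listed by
increasing maximum.) -/
def bellPoly (i j : ℕ) (x : ℕ → ℂ) : ℂ :=
  ∑ c : OrderedFinpartition i, if c.length = j then ∏ m, x (c.partSize m) else 0

/-- The matrix `(ℬ_n φ)(z)`: the `(0, 0)` entry is `1`, the other entries of row `0` and column `0`
vanish, and the `(i, j)` entry is `B_{i,j}(φ'(z), …, φ^(i-j+1)(z))` for `1 ≤ j ≤ i`. -/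
def bellMatrix (n : ℕ) (φ : ℂ → ℂ) (z : ℂ) : Matrix (Fin (n + 1)) (Fin (n + 1)) ℂ :=
  Matrix.of fun i j ↦
    if i = 0 ∧ j = 0 then 1
    else if i = 0 ∨ j = 0 then 0
    else if j ≤ i then bellPoly i j (fun k ↦ iteratedDeriv k φ z)
    else 0

/-- The values `f(z, ·)` of a vector `f` of a space of functions on `Ω × Ω`, extended by `0`
outside `Ω`. -/
def slice {Ω : Set ℂ} (f : Ω × Ω → ℂ) (z : Ω) : ℂ → ℂ :=
  Function.extend (Subtype.val : Ω → ℂ) (fun ζ ↦ f (z, ζ)) 0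

section Jet

variable {Ω : Set ℂ} (H₁ H₂ : Type*)
  [NormedAddCommGroup H₁] [InnerProductSpace ℂ H₁] [CompleteSpace H₁] [RKHS ℂ H₁ Ω ℂ]
  [NormedAddCommGroup H₂] [InnerProductSpace ℂ H₂] [CompleteSpace H₂] [RKHS ℂ H₂ Ω ℂ]

/-- `𝒜_n`: the vectors `f` of `H₁ ⊗ H₂` with `(∂/∂ζ)^i f (z, ζ) = 0` on the diagonal `ζ = z`,
for all `0 ≤ i ≤ n`. -/
def jetKer (n : ℕ) : Set (HilbertTensor H₁ H₂) :=
  {f | ∀ i ≤ n, ∀ z : Ω, iteratedDeriv i (slice (⇑f : Ω × Ω → ℂ) z) z = 0}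

/-- `𝒜_n^⊥`, the orthogonal complement of `𝒜_n`. (The span is only there because `𝒜_n` is
a plain set in this formalization; it has the same orthogonal complement.) -/
def jetKerPerp (n : ℕ) : Submodule ℂ (HilbertTensor H₁ H₂) :=
  (Submodule.span ℂ (jetKer H₁ H₂ n))ᗮ

instance (n : ℕ) : (jetKerPerp H₁ H₂ n).HasOrthogonalProjection := by
  unfold jetKerPerp
  infer_instance

end Jet

end

/-! The space `𝒜_n^⊥`, viewed through jets along the diagonal, is a concrete model of the space with
the jet kernel. By Cauchy's estimates `h ↦ h^(i)(z)` is bounded on `H₂`, hence represented by a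
vector `d z i` (`exists_inner_eq_iteratedDeriv`). With `k_z` the kernel function of `H₁`, the vector
`e z i = k_z ⊗ d z i` then represents `f ↦ (∂/∂ζ)^i f(z, ζ)` at `ζ = z`. The vectors `e z i`, `i ≤
n`, have `𝒜_n` as their orthogonal complement, so they lie in `𝒜_n^⊥` and separate its points.
Sending `f` to the functions `⟪e z i, f⟫` makes `𝒜_n^⊥` a space of `ℂ^(n+1)`-valued functions whose
kernel is the Gram matrix of the `e z i` (`RKHS.kernel_ofVectors`), and this is the jet kernel
(`inner_jetVector_jetVector`). Positivity follows.

By Leibniz and Faà di Bruno, the jet of `(T₁ ⊗ T₂) f` at `z` is the weight matrix applied to the jet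
of `f` at `φ z` (`inner_jetVector_map`). Projecting to `𝒜_n^⊥` does not change jets, so the
compression is the weighted composition operator on this model. Uniqueness of the space with a given
kernel carries it to any other model, and the norm bound is that of a compression. -/

/-! ### Reproducing kernel Hilbert spaces -/

section RKHS

/-- Two reproducing kernel Hilbert spaces with the same kernel are the same space of functions,
isometrically. -/
theorem RKHS.exists_linearIsometryEquiv {X V E F : Type*}
    [NormedAddCommGroup V] [InnerProductSpace ℂ V] [CompleteSpace V]
    [NormedAddCommGroup E] [InnerProductSpace ℂ E] [CompleteSpace E] [RKHS ℂ E X V]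
    [NormedAddCommGroup F] [InnerProductSpace ℂ F] [CompleteSpace F] [RKHS ℂ F X V]
    (h : RKHS.kernel E = RKHS.kernel F) :
    ∃ U : E ≃ₗᵢ[ℂ] F, ∀ (f : E) (x : X), U f x = f x := by
  -- Formal combinations of kernel functions have dense image in both spaces, and their inner
  -- products depend only on the kernel. The identity on coefficients therefore extends to a
  -- unitary.
  let e₁ : (X × V →₀ ℂ) →ₗ[ℂ] E :=
    Finsupp.linearCombination ℂ fun p : X × V ↦ RKHS.kerFun E p.1 p.2
  let e₂ : (X × V →₀ ℂ) →ₗ[ℂ] F :=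
    Finsupp.linearCombination ℂ fun p : X × V ↦ RKHS.kerFun F p.1 p.2
  have hd₁ : DenseRange e₁ := by
    have hr : Set.range e₁ = (Submodule.span ℂ {RKHS.kerFun E x v | (x) (v)} : Set E) := by
      rw [← LinearMap.coe_range, Finsupp.range_linearCombination]
      congr 2
      ext; simp
    rw [DenseRange, hr, Submodule.dense_iff_topologicalClosure_eq_top]
    exact RKHS.kerFun_dense E
  have hd₂ : DenseRange e₂ := by
    have hr : Set.range e₂ = (Submodule.span ℂ {RKHS.kerFun F x v | (x) (v)} : Set F) := by
      rw [← LinearMap.coe_range, Finsupp.range_linearCombination]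
      congr 2
      ext; simp
    rw [DenseRange, hr, Submodule.dense_iff_topologicalClosure_eq_top]
    exact RKHS.kerFun_dense F
  have hn : ∀ c, ‖e₂ (LinearEquiv.refl ℂ _ c)‖ = ‖e₁ c‖ := by
    intro c
    have : ⟪e₂ c, e₂ c⟫_ℂ = ⟪e₁ c, e₁ c⟫_ℂ := by
      simp only [e₁, e₂, Finsupp.linearCombination_apply, Finsupp.sum_inner, Finsupp.inner_sum,
        inner_smul_left, inner_smul_right, ← RKHS.kernel_inner, h]
    rw [LinearEquiv.refl_apply, ← sq_eq_sq₀ (norm_nonneg _) (norm_nonneg _),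
      @norm_sq_eq_re_inner ℂ, @norm_sq_eq_re_inner ℂ, this]
  let U := (LinearEquiv.refl ℂ (X × V →₀ ℂ)).extendOfIsometry e₁ e₂ hd₁ hd₂ hn
  refine ⟨U, fun f x ↦ ext_inner_left ℂ fun v ↦ ?_⟩
  have hU : U (RKHS.kerFun E x v) = RKHS.kerFun F x v := by
    have := (LinearEquiv.refl ℂ (X × V →₀ ℂ)).extendOfIsometry_eq e₁ e₂ hd₁ hd₂ hn
      (Finsupp.single (x, v) 1)
    simpa [e₁, e₂] using this
  rw [← RKHS.kerFun_inner, ← hU, U.inner_map_map, RKHS.kerFun_inner]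

variable {X ι E : Type*} [Fintype ι] [NormedAddCommGroup E] [InnerProductSpace ℂ E]

/-- A space of `ℂ^ι`-valued functions on `X` from vectors `e x i` that separate the points of the
subspace `S`: the `i`-th coordinate of `f x` is `⟪e x i, f⟫`. -/
noncomputable abbrev RKHS.ofVectors (S : Submodule ℂ E) (e : X → ι → E)
    (hS : ∀ f ∈ S, (∀ x i, ⟪e x i, f⟫_ℂ = 0) → f = 0) : RKHS ℂ S X (EuclideanSpace ℂ ι) where
  coeCLM := ContinuousLinearMap.pi fun x ↦
    (EuclideanSpace.equiv ι ℂ).symm.toContinuousLinearMap ∘L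
      (ContinuousLinearMap.pi fun i ↦ innerSL ℂ (e x i) ∘L S.subtypeL)
  coeCLM_injective := by
    refine (injective_iff_map_eq_zero _).mpr fun f h ↦ Subtype.ext (hS f f.2 fun x i ↦ ?_)
    exact congrFun (congrArg WithLp.ofLp (congrFun h x)) i

theorem RKHS.ofVectors_apply (S : Submodule ℂ E) (e : X → ι → E)
    (hS : ∀ f ∈ S, (∀ x i, ⟪e x i, f⟫_ℂ = 0) → f = 0) (f : S) (x : X) (i : ι) :
    letI := RKHS.ofVectors S e hS
    (f x : EuclideanSpace ℂ ι) i = ⟪e x i, f⟫_ℂ := rfl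

/-- Since the `e y j` lie in `S`, the kernel function at `y` in direction `v` is `∑ j, v j • e y j`;
its coordinates are read off from inner products. -/
theorem RKHS.kernel_ofVectors [DecidableEq ι] (S : Submodule ℂ E) [CompleteSpace S]
    (e : X → ι → E) (hS : ∀ f ∈ S, (∀ x i, ⟪e x i, f⟫_ℂ = 0) → f = 0) (he : ∀ x i, e x i ∈ S) :
    letI := RKHS.ofVectors S e hS
    RKHS.kernel S = Matrix.of fun x y ↦
      Matrix.toEuclideanCLM (𝕜 := ℂ) (Matrix.of fun i j ↦ ⟪e x i, e y j⟫_ℂ) := by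
  let _ := RKHS.ofVectors S e hS
  have hk : ∀ (y : X) (v : EuclideanSpace ℂ ι),
      RKHS.kerFun S y v = ∑ j, v j • (⟨e y j, he y j⟩ : S) := by
    intro y v
    refine ext_inner_right ℂ fun f ↦ ?_
    rw [RKHS.kerFun_inner, sum_inner, PiLp.inner_apply]
    refine Finset.sum_congr rfl fun j _ ↦ ?_
    rw [RKHS.ofVectors_apply, inner_smul_left, Submodule.coe_inner]
    simp [mul_comm]
  ext x y v i
  rw [← RKHS.kerFun_apply, hk, RKHS.ofVectors_apply]
  simp [Matrix.mulVec, dotProduct, mul_comm]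

end RKHS

/-! ### Hilbert space tensor products -/

section Tensor

variable {H₁ H₂ : Type*}
  [NormedAddCommGroup H₁] [InnerProductSpace ℂ H₁]
  [NormedAddCommGroup H₂] [InnerProductSpace ℂ H₂]

theorem HilbertTensor.norm_map_le (T₁ : H₁ →L[ℂ] H₁) (T₂ : H₂ →L[ℂ] H₂) :
    ‖HilbertTensor.map T₁ T₂‖ ≤ ‖T₁‖ * ‖T₂‖ := by
  refine (ContinuousLinearMap.opNorm_extend_le (N := 1) _ Completion.denseRange_coe
    (by simp)).trans ?_
  rw [NNReal.coe_one, one_mul]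
  refine ContinuousLinearMap.opNorm_le_bound _ (by positivity) fun x ↦ ?_
  rw [ContinuousLinearMap.comp_apply, Completion.coe_toComplL, Completion.norm_coe]
  exact (TensorProduct.mapL T₁ T₂).le_of_opNorm_le (TensorProduct.norm_mapL_le T₁ T₂) x

/-- Continuous linear maps on the Hilbert space tensor product are determined by their values on
elementary tensors. -/
theorem HilbertTensor.clm_ext {F : Type*} [NormedAddCommGroup F] [NormedSpace ℂ F]
    {A B : HilbertTensor H₁ H₂ →L[ℂ] F}
    (h : ∀ a b, A (HilbertTensor.tmul a b) = B (HilbertTensor.tmul a b)) : A = B := by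
  refine ContinuousLinearMap.ext fun f ↦ ?_
  refine congrFun (Completion.denseRange_coe.equalizer A.continuous B.continuous
    (funext fun t ↦ ?_)) f
  induction t using TensorProduct.induction_on with
  | zero =>
    rw [Function.comp_apply, Function.comp_apply, Completion.coe_zero, map_zero, map_zero]
  | tmul a b => exact h a b
  | add s t hs ht =>
    simp only [Function.comp_apply] at hs ht ⊢
    rw [Completion.coe_add, map_add, map_add, hs, ht]

/-- The bounded operator `b ↦ a ⊗ b`. -/
noncomputable def HilbertTensor.tmulLeft (a : H₁) : H₂ →L[ℂ] HilbertTensor H₁ H₂ :=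
  Completion.toComplL ∘L TensorProduct.mkL ℂ H₁ H₂ a

variable [CompleteSpace H₂]

/-- The contraction of a tensor by a vector in the first variable. -/
noncomputable def HilbertTensor.contract (a : H₁) : HilbertTensor H₁ H₂ →L[ℂ] H₂ :=
  (HilbertTensor.tmulLeft a).adjoint

theorem HilbertTensor.inner_contract (a : H₁) (b : H₂) (f : HilbertTensor H₁ H₂) :
    ⟪b, HilbertTensor.contract a f⟫_ℂ = ⟪HilbertTensor.tmul a b, f⟫_ℂ := by
  rw [HilbertTensor.contract, ContinuousLinearMap.adjoint_inner_right]
  rfl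

variable [CompleteSpace H₁] {X Y : Type*} [RKHS ℂ H₁ X ℂ] [RKHS ℂ H₂ Y ℂ]

/-- Freezing the first variable is a contraction by a kernel function, so every slice `f(x, ·)` is
itself a vector of `H₂`. -/
theorem HilbertTensor.contract_kerFun_apply (f : HilbertTensor H₁ H₂) (x : X) (y : Y) :
    HilbertTensor.contract (RKHS.kerFun H₁ x 1) f y = f (x, y) := by
  rw [HilbertTensor.apply_eq, ← HilbertTensor.inner_contract, RKHS.kerFun_inner]
  simp

/-- The values of the tensor product of two weighted composition operators. -/
theorem HilbertTensor.map_apply_of_isWeightedComposition {a₁ : X → ℂ} {a₂ : Y → ℂ}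
    {φ₁ : X → X} {φ₂ : Y → Y} {T₁ : H₁ →L[ℂ] H₁} {T₂ : H₂ →L[ℂ] H₂}
    (hT₁ : IsWeightedComposition (fun x ↦ a₁ x • ContinuousLinearMap.id ℂ ℂ) φ₁ T₁)
    (hT₂ : IsWeightedComposition (fun y ↦ a₂ y • ContinuousLinearMap.id ℂ ℂ) φ₂ T₂)
    (f : HilbertTensor H₁ H₂) (x : X) (y : Y) :
    HilbertTensor.map T₁ T₂ f (x, y) = a₁ x * a₂ y * f (φ₁ x, φ₂ y) := by
  -- Both sides are continuous functionals of the tensor, so elementary tensors suffice.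
  have h : (innerSL ℂ (HilbertTensor.tmul (RKHS.kerFun H₁ x 1) (RKHS.kerFun H₂ y 1))) ∘L
      HilbertTensor.map T₁ T₂ = (a₁ x * a₂ y) •
      innerSL ℂ (HilbertTensor.tmul (RKHS.kerFun H₁ (φ₁ x) 1) (RKHS.kerFun H₂ (φ₂ y) 1)) := by
    refine HilbertTensor.clm_ext fun g h ↦ ?_
    simp only [ContinuousLinearMap.comp_apply, innerSL_apply_apply, HilbertTensor.map_tmul,
      HilbertTensor.inner_tmul, smul_apply, RKHS.kerFun_inner, hT₁ g x,
      hT₂ h y]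
    simp
    ring
  exact DFunLike.congr_fun h f

end Tensor

/-! ### Holomorphy of the functions in a reproducing kernel Hilbert space -/

section Holomorphic

variable {Ω : Set ℂ} {K : ℂ → ℂ → ℂ}

theorem SesquiAnalyticOn.differentiableOn_left (hK : SesquiAnalyticOn Ω K) {w : ℂ} (hw : w ∈ Ω) :
    DifferentiableOn ℂ (fun z ↦ K z w) Ω := by
  have h := hK.comp (f := fun z : ℂ ↦ (z, conj w)) (s := Ω) (by fun_prop)
    (fun z hz ↦ ⟨hz, by simpa using hw⟩)
  simpa [Function.comp_def] using h

theorem SesquiAnalyticOn.continuousOn_diag (hK : SesquiAnalyticOn Ω K) :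
    ContinuousOn (fun z ↦ K z z) Ω := by
  have h := hK.continuousOn.comp (f := fun z : ℂ ↦ (z, conj z)) (s := Ω)
    (by fun_prop) (fun z hz ↦ ⟨hz, by simpa using hz⟩)
  simpa [Function.comp_def] using h

variable {H : Type*} [NormedAddCommGroup H] [InnerProductSpace ℂ H] [RKHS ℂ H Ω ℂ]

/-- The function on `Ω` given by a vector of `H`, extended by `0` to `ℂ`. -/
noncomputable def zeroExtend (h : H) : ℂ → ℂ :=
  Function.extend (Subtype.val : Ω → ℂ) h 0

theorem zeroExtend_apply (h : H) (z : Ω) : zeroExtend h z = h z :=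
  Subtype.val_injective.extend_apply _ _ _

theorem zeroExtend_of_mem (h : H) {z : ℂ} (hz : z ∈ Ω) : zeroExtend h z = h ⟨z, hz⟩ :=
  zeroExtend_apply h ⟨z, hz⟩

theorem zeroExtend_of_notMem (h : H) {z : ℂ} (hz : z ∉ Ω) : zeroExtend h z = 0 :=
  Function.extend_apply' _ _ _ (by simpa using hz)

theorem zeroExtend_add (g h : H) : zeroExtend (g + h) = zeroExtend g + zeroExtend h := by
  ext z
  by_cases hz : z ∈ Ω
  · simp [zeroExtend_of_mem _ hz]
  · simp [zeroExtend_of_notMem _ hz]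

theorem zeroExtend_smul (c : ℂ) (h : H) : zeroExtend (c • h) = c • zeroExtend h := by
  ext z
  by_cases hz : z ∈ Ω
  · simp [zeroExtend_of_mem _ hz]
  · simp [zeroExtend_of_notMem _ hz]

variable [CompleteSpace H]

theorem kerFun_one_apply (hH : RKHS.kernel H = scalarKernel Ω K) (z w : Ω) :
    RKHS.kerFun H w 1 z = K z w := by
  rw [RKHS.kerFun_apply, hH]
  simp [scalarKernel]

/-- Point evaluation at `z` has norm at most `√‖K(z, z)‖`, and the diagonal of `K` is continuous,
hence bounded on compact sets. -/
theorem exists_norm_zeroExtend_le (hK : SesquiAnalyticOn Ω K)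
    (hH : RKHS.kernel H = scalarKernel Ω K) {C : Set ℂ} (hC : IsCompact C) (hCΩ : C ⊆ Ω) :
    ∃ B : ℝ, ∀ (h : H), ∀ z ∈ C, ‖zeroExtend h z‖ ≤ B * ‖h‖ := by
  obtain ⟨B, hB⟩ := hC.exists_bound_of_continuousOn (hK.continuousOn_diag.mono hCΩ)
  refine ⟨√B, fun h z hz ↦ ?_⟩
  rw [zeroExtend_of_mem h (hCΩ hz), mul_comm]
  refine (RKHS.norm_apply_le h _).trans ?_
  gcongr
  rw [hH]
  simpa [scalarKernel, norm_smul] using hB z hz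

/-- Combinations of kernel functions are holomorphic and dense; by `exists_norm_zeroExtend_le` norm
convergence is locally uniform, which preserves holomorphy. -/
theorem differentiableOn_zeroExtend (hΩ : IsOpen Ω) (hK : SesquiAnalyticOn Ω K)
    (hH : RKHS.kernel H = scalarKernel Ω K) (h : H) : DifferentiableOn ℂ (zeroExtend h) Ω := by
  have hspan : ∀ g ∈ Submodule.span ℂ {RKHS.kerFun H x v | (x) (v)},
      DifferentiableOn ℂ (zeroExtend g) Ω := by
    intro g hg
    induction hg using Submodule.span_induction with
    | mem g hg =>
      obtain ⟨w, v, rfl⟩ := hg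
      refine ((hK.differentiableOn_left w.2).const_mul v).congr fun z hz ↦ ?_
      rw [zeroExtend_of_mem _ hz, ← mul_one v, ← smul_eq_mul, map_smul, RKHS.coe_smul,
        Pi.smul_apply, kerFun_one_apply hH, smul_eq_mul, smul_eq_mul, mul_one]
    | zero =>
      refine (differentiableOn_const (0 : ℂ)).congr fun z hz ↦ ?_
      simp [zeroExtend_of_mem _ hz]
    | add f g _ _ hf hg => rw [zeroExtend_add]; exact hf.add hg
    | smul c g _ hg => rw [zeroExtend_smul]; exact hg.const_smul c
  have hmem : h ∈ closure (Submodule.span ℂ {RKHS.kerFun H x v | (x) (v)} : Set H) := by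
    rw [← Submodule.topologicalClosure_coe, RKHS.kerFun_dense H]
    trivial
  obtain ⟨u, hu, hlim⟩ := mem_closure_iff_seq_limit.mp hmem
  refine TendstoLocallyUniformlyOn.differentiableOn (φ := Filter.atTop)
    (F := fun n ↦ zeroExtend (u n)) ?_ (Filter.Eventually.of_forall fun n ↦ hspan _ (hu n)) hΩ
  rw [tendstoLocallyUniformlyOn_iff_forall_isCompact hΩ]
  intro C hCΩ hC
  obtain ⟨B, hB⟩ := exists_norm_zeroExtend_le hK hH hC hCΩ
  rw [Metric.tendstoUniformlyOn_iff]
  intro ε hε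
  have h0 : Filter.Tendsto (fun n ↦ B * ‖h - u n‖) Filter.atTop (nhds 0) := by
    have := ((tendsto_const_nhds (x := h)).sub hlim).norm.const_mul B
    simpa using this
  filter_upwards [h0.eventually (gt_mem_nhds hε)] with n hn z hz
  have : zeroExtend h z - zeroExtend (u n) z = zeroExtend (h - u n) z := by
    simp [zeroExtend_of_mem _ (hCΩ hz)]
  rw [dist_eq_norm, this]
  exact (hB _ z hz).trans_lt hn

theorem contDiffAt_zeroExtend (hΩ : IsOpen Ω) (hK : SesquiAnalyticOn Ω K)
    (hH : RKHS.kernel H = scalarKernel Ω K) (h : H) {z : ℂ} (hz : z ∈ Ω) {n : WithTop ℕ∞} :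
    ContDiffAt ℂ n (zeroExtend h) z :=
  ((differentiableOn_zeroExtend hΩ hK hH h).analyticAt (hΩ.mem_nhds hz)).contDiffAt

/-- Evaluation of a derivative is a bounded functional. -/
theorem exists_inner_eq_iteratedDeriv (hΩ : IsOpen Ω) (hK : SesquiAnalyticOn Ω K)
    (hH : RKHS.kernel H = scalarKernel Ω K) (z : Ω) (i : ℕ) :
    ∃ d : H, ∀ h : H, ⟪d, h⟫_ℂ = iteratedDeriv i (zeroExtend h) z := by
  obtain ⟨r, hr, hrΩ⟩ := Metric.nhds_basis_closedBall.mem_iff.mp (hΩ.mem_nhds z.2)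
  obtain ⟨B, hB⟩ := exists_norm_zeroExtend_le hK hH (isCompact_closedBall (z : ℂ) r) hrΩ
  have hd := fun h : H ↦ differentiableOn_zeroExtend hΩ hK hH h
  let l : H →ₗ[ℂ] ℂ :=
    { toFun := fun h ↦ iteratedDeriv i (zeroExtend h) z
      map_add' := fun g h ↦ by
        rw [zeroExtend_add]
        exact iteratedDeriv_add (contDiffAt_zeroExtend hΩ hK hH g z.2)
          (contDiffAt_zeroExtend hΩ hK hH h z.2)
      map_smul' := fun c h ↦ by
        rw [zeroExtend_smul]
        exact iteratedDeriv_const_smul (contDiffAt_zeroExtend hΩ hK hH h z.2) c }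
  -- The constant is Cauchy's estimate on the circle of radius `r`, with `B * ‖h‖` bounding `h`
  -- there.
  let L : H →L[ℂ] ℂ := l.mkContinuous (i.factorial * B / r ^ i) fun h ↦ by
    have := Complex.norm_iteratedDeriv_le_of_forall_mem_sphere_norm_le i hr
      (((hd h).mono (Metric.closure_ball_subset_closedBall.trans hrΩ)).diffContOnCl)
      (fun w hw ↦ hB h w (Metric.sphere_subset_closedBall hw))
    refine this.trans_eq ?_
    ring
  refine ⟨(InnerProductSpace.toDual ℂ H).symm L, fun h ↦ ?_⟩
  rw [InnerProductSpace.toDual_symm_apply]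
  rfl

theorem iteratedDeriv_conj_conj (f : ℂ → ℂ) (n : ℕ) (z : ℂ) :
    iteratedDeriv n (fun u ↦ conj (f (conj u))) z = conj (iteratedDeriv n f (conj z)) := by
  induction n generalizing z with
  | zero => simp
  | succ n ih =>
    rw [iteratedDeriv_succ, iteratedDeriv_succ, funext ih]
    exact congrFun (deriv_conj_conj (f := iteratedDeriv n f)) z

/-- Pairing with `d z i` differentiates `d w j` at `z`. The value of `d w j` at `z'` is the
conjugate of the `j`-th derivative at `w` of the kernel function at `z'`, and
`iteratedDeriv_conj_conj` turns this into a derivative in `u = w̄`. -/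
theorem inner_eq_mixedDeriv (hΩ : IsOpen Ω) (hH : RKHS.kernel H = scalarKernel Ω K)
    {d : Ω → ℕ → H} (hd : ∀ z i h, ⟪d z i, h⟫_ℂ = iteratedDeriv i (zeroExtend h) z)
    (z w : Ω) (i j : ℕ) : ⟪d z i, d w j⟫_ℂ = mixedDeriv K i j z w := by
  rw [hd, mixedDeriv]
  refine Filter.EventuallyEq.iteratedDeriv_eq i ?_
  filter_upwards [hΩ.mem_nhds z.2] with z' hz'
  have h1 : zeroExtend (d w j) z' = conj ⟪d w j, RKHS.kerFun H ⟨z', hz'⟩ 1⟫_ℂ := by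
    rw [inner_conj_symm, RKHS.kerFun_inner, zeroExtend_of_mem _ hz']
    simp
  have h2 := iteratedDeriv_conj_conj (zeroExtend (RKHS.kerFun H ⟨z', hz'⟩ 1)) j (conj (w : ℂ))
  rw [Complex.conj_conj] at h2
  rw [h1, hd, ← h2]
  refine Filter.EventuallyEq.iteratedDeriv_eq j ?_
  have hconj : Continuous fun u : ℂ ↦ conj u := by fun_prop
  filter_upwards [(hΩ.preimage hconj).mem_nhds (show conj (w : ℂ) ∈ _ by simp)] with u hu
  rw [zeroExtend_of_mem _ (show conj u ∈ Ω from hu), kerFun_one_apply hH]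
  have h3 := kerFun_one_apply hH ⟨z', hz'⟩ ⟨conj u, hu⟩
  have h4 := kerFun_one_apply hH ⟨conj u, hu⟩ ⟨z', hz'⟩
  -- Hermitian symmetry of `K` on `Ω` comes from writing its values as inner products of kernel
  -- functions.
  have e1 : ⟪RKHS.kerFun H ⟨z', hz'⟩ (1 : ℂ), RKHS.kerFun H ⟨conj u, hu⟩ (1 : ℂ)⟫_ℂ
      = K z' (conj u) := by
    rw [RKHS.kerFun_inner, h3]; simp
  have e2 : ⟪RKHS.kerFun H ⟨conj u, hu⟩ (1 : ℂ), RKHS.kerFun H ⟨z', hz'⟩ (1 : ℂ)⟫_ℂ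
      = K (conj u) z' := by
    rw [RKHS.kerFun_inner, h4]; simp
  rw [← e1, ← e2, inner_conj_symm]

end Holomorphic

/-! ### Derivatives of weighted compositions -/

section Bell

/-- The exceptional entries are no exception: only the empty set has a partition into zero blocks,
and a partition of `i` points has at most `i` blocks. -/
theorem bellMatrix_apply (n : ℕ) (φ : ℂ → ℂ) (z : ℂ) (i j : Fin (n + 1)) :
    bellMatrix n φ z i j = bellPoly i j fun k ↦ iteratedDeriv k φ z := by
  have hzero : ∀ {i j : ℕ} (x : ℕ → ℂ), (∀ c : OrderedFinpartition i, c.length ≠ j) →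
      bellPoly i j x = 0 := fun x h ↦ Finset.sum_eq_zero fun c _ ↦ if_neg (h c)
  obtain ⟨i, hi⟩ := i
  obtain ⟨j, hj⟩ := j
  simp only [bellMatrix, Matrix.of_apply, Fin.mk_eq_zero, Fin.mk_le_mk]
  split_ifs with h₁ h₂ h₃
  · obtain ⟨rfl, rfl⟩ := h₁
    simp [bellPoly, OrderedFinpartition.atomic]
  · refine (hzero _ fun c ↦ ?_).symm
    have := c.length_le
    rcases h₂ with rfl | rfl
    · omega
    · exact (c.length_pos (by omega)).ne'
  · rfl
  · exact (hzero _ fun c ↦ by have := c.length_le; omega).symm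

/-- Faà di Bruno's formula in matrix form. -/
theorem iteratedDeriv_comp_eq_sum_bellMatrix {n : ℕ} {g φ : ℂ → ℂ} {z : ℂ}
    (hg : ContDiffAt ℂ n g (φ z)) (hφ : ContDiffAt ℂ n φ z) (i : Fin (n + 1)) :
    iteratedDeriv i (g ∘ φ) z = ∑ j, bellMatrix n φ z i j * iteratedDeriv j g (φ z) := by
  have hi : (i : ℕ) ≤ n := Nat.lt_succ_iff.mp i.2
  rw [iteratedDeriv_scomp_eq_sum_orderedFinpartition hg hφ (i := i) (by exact_mod_cast hi)]
  simp only [bellMatrix_apply, bellPoly, Finset.sum_mul, ite_mul, zero_mul]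
  rw [Finset.sum_comm]
  refine Finset.sum_congr rfl fun c _ ↦ ?_
  have hc : c.length < n + 1 := by have := c.length_le; omega
  -- Each partition contributes only to the column indexed by its number of blocks.
  rw [Finset.sum_eq_single ⟨c.length, hc⟩ (fun j _ hj ↦ if_neg fun h ↦ hj (Fin.ext h.symm))
    (by simp)]
  simp

/-- Leibniz' rule in matrix form. -/
theorem iteratedDeriv_mul_eq_sum_jetMatrix {n : ℕ} {ψ g : ℂ → ℂ} {z : ℂ}
    (hψ : ContDiffAt ℂ n ψ z) (hg : ContDiffAt ℂ n g z) (i : Fin (n + 1)) :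
    iteratedDeriv i (ψ * g) z = ∑ j, jetMatrix n ψ z i j * iteratedDeriv j g z := by
  have hi : ((i : ℕ) : WithTop ℕ∞) ≤ n := by exact_mod_cast Nat.lt_succ_iff.mp i.2
  -- The factors are swapped so that the summation index is the order of the derivative of `g`.
  rw [mul_comm, iteratedDeriv_mul (hg.of_le hi) (hψ.of_le hi)]
  simp only [jetMatrix, Matrix.of_apply, ite_mul, zero_mul, Fin.le_def]
  rw [Fin.sum_univ_eq_sum_range (fun j ↦ if j ≤ (i : ℕ) then
    ((i : ℕ).choose j : ℂ) * iteratedDeriv ((i : ℕ) - j) ψ z * iteratedDeriv j g z else 0) (n + 1),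
    ← Finset.sum_filter]
  refine Finset.sum_congr ?_ fun j _ ↦ by ring
  ext j
  simp only [Finset.mem_range, Finset.mem_filter]
  omega

theorem iteratedDeriv_mul_comp_eq_sum {n : ℕ} {ψ g φ : ℂ → ℂ} {z : ℂ}
    (hψ : ContDiffAt ℂ n ψ z) (hg : ContDiffAt ℂ n g (φ z)) (hφ : ContDiffAt ℂ n φ z)
    (i : Fin (n + 1)) :
    iteratedDeriv i (ψ * (g ∘ φ)) z =
      ∑ j, (jetMatrix n ψ z * bellMatrix n φ z) i j * iteratedDeriv j g (φ z) := by
  rw [iteratedDeriv_mul_eq_sum_jetMatrix hψ (hg.comp z hφ)]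
  simp only [iteratedDeriv_comp_eq_sum_bellMatrix hg hφ, Matrix.mul_apply, Finset.mul_sum,
    Finset.sum_mul, ← mul_assoc]
  exact Finset.sum_comm

end Bell

/-! ### Jets of vectors in the tensor product -/

section Jets

variable {Ω : Set ℂ} {H₁ H₂ : Type*}
  [NormedAddCommGroup H₁] [InnerProductSpace ℂ H₁] [CompleteSpace H₁] [RKHS ℂ H₁ Ω ℂ]
  [NormedAddCommGroup H₂] [InnerProductSpace ℂ H₂] [CompleteSpace H₂] [RKHS ℂ H₂ Ω ℂ]

theorem slice_eq_zeroExtend (f : HilbertTensor H₁ H₂) (z : Ω) :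
    slice (⇑f : Ω × Ω → ℂ) z =
      zeroExtend (HilbertTensor.contract (H₂ := H₂) (RKHS.kerFun H₁ z 1) f) := by
  rw [slice, zeroExtend]
  congr 1
  ext ζ
  exact (HilbertTensor.contract_kerFun_apply f z ζ).symm

variable {d : Ω → ℕ → H₂}

/-- The vector of `H₁ ⊗ H₂` which represents `f ↦ (∂/∂ζ)^i f(z, ζ)` at `ζ = z`, for vectors `d z i`
which represent `h ↦ h^(i)(z)`. -/
noncomputable def jetVector (H₁ : Type*) [NormedAddCommGroup H₁] [InnerProductSpace ℂ H₁]
    [CompleteSpace H₁] [RKHS ℂ H₁ Ω ℂ] (d : Ω → ℕ → H₂) (z : Ω) (i : ℕ) : HilbertTensor H₁ H₂ :=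
  HilbertTensor.tmul (RKHS.kerFun H₁ z 1) (d z i)

theorem inner_jetVector (hd : ∀ z i h, ⟪d z i, h⟫_ℂ = iteratedDeriv i (zeroExtend h) z)
    (z : Ω) (i : ℕ) (f : HilbertTensor H₁ H₂) :
    ⟪jetVector H₁ d z i, f⟫_ℂ = iteratedDeriv i (slice (⇑f : Ω × Ω → ℂ) z) z := by
  rw [slice_eq_zeroExtend, ← hd, HilbertTensor.inner_contract, jetVector]

theorem mem_jetKer_iff (hd : ∀ z i h, ⟪d z i, h⟫_ℂ = iteratedDeriv i (zeroExtend h) z)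
    (n : ℕ) (f : HilbertTensor H₁ H₂) :
    f ∈ jetKer H₁ H₂ n ↔ ∀ (z : Ω) (i : Fin (n + 1)), ⟪jetVector H₁ d z i, f⟫_ℂ = 0 := by
  simp only [inner_jetVector hd]
  exact ⟨fun h z i ↦ h i (Nat.lt_succ_iff.mp i.2) z,
    fun h i hi z ↦ h z ⟨i, Nat.lt_succ_iff.mpr hi⟩⟩

theorem jetVector_mem_jetKerPerp (hd : ∀ z i h, ⟪d z i, h⟫_ℂ = iteratedDeriv i (zeroExtend h) z)
    (n : ℕ) (z : Ω) (i : Fin (n + 1)) :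
    jetVector H₁ d z i ∈ jetKerPerp H₁ H₂ n := by
  rw [jetKerPerp, Submodule.mem_orthogonal']
  intro f hf
  induction hf using Submodule.span_induction with
  | mem f hf => exact (mem_jetKer_iff hd n f).mp hf z i
  | zero => simp
  | add f g _ _ hf hg => rw [inner_add_right, hf, hg, add_zero]
  | smul c f _ hf => rw [inner_smul_right, hf, mul_zero]

/-- A vector of `𝒜_n^⊥` with vanishing jets also lies in `𝒜_n`, so it is orthogonal to itself. -/
theorem eq_zero_of_mem_jetKerPerp (hd : ∀ z i h, ⟪d z i, h⟫_ℂ = iteratedDeriv i (zeroExtend h) z)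
    (n : ℕ) (f : HilbertTensor H₁ H₂) (hf : f ∈ jetKerPerp H₁ H₂ n)
    (h : ∀ (z : Ω) (i : Fin (n + 1)), ⟪jetVector H₁ d z i, f⟫_ℂ = 0) : f = 0 := by
  have h1 : f ∈ Submodule.span ℂ (jetKer H₁ H₂ n) :=
    Submodule.subset_span ((mem_jetKer_iff hd n f).mpr h)
  exact inner_self_eq_zero.mp (Submodule.inner_right_of_mem_orthogonal h1 hf)

theorem inner_jetVector_jetVector
    (hd : ∀ z i h, ⟪d z i, h⟫_ℂ = iteratedDeriv i (zeroExtend h) z)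
    (hΩ : IsOpen Ω) {K₁ K₂ : ℂ → ℂ → ℂ}
    (hH₁ : RKHS.kernel H₁ = scalarKernel Ω K₁) (hH₂ : RKHS.kernel H₂ = scalarKernel Ω K₂)
    (z w : Ω) (i j : ℕ) :
    ⟪jetVector H₁ d z i, jetVector H₁ d w j⟫_ℂ = K₁ z w * mixedDeriv K₂ i j z w := by
  rw [jetVector, jetVector, HilbertTensor.inner_tmul, inner_eq_mixedDeriv hΩ hH₂ hd,
    RKHS.kerFun_inner, kerFun_one_apply hH₁]
  simp

/-- The jets of the image of `f` under the tensor product of two weighted composition operators. -/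
theorem inner_jetVector_map (hd : ∀ z i h, ⟪d z i, h⟫_ℂ = iteratedDeriv i (zeroExtend h) z)
    (n : ℕ) (hΩ : IsOpen Ω) {K₂ : ℂ → ℂ → ℂ} (hK₂ : SesquiAnalyticOn Ω K₂)
    (hH₂ : RKHS.kernel H₂ = scalarKernel Ω K₂) {ψ₁ ψ₂ φ : ℂ → ℂ}
    (hψ₂ : DifferentiableOn ℂ ψ₂ Ω) (hφ : DifferentiableOn ℂ φ Ω) (hφΩ : Set.MapsTo φ Ω Ω)
    {T₁ : H₁ →L[ℂ] H₁} {T₂ : H₂ →L[ℂ] H₂}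
    (hT₁ : IsWeightedComposition (fun z : Ω ↦ ψ₁ z • ContinuousLinearMap.id ℂ ℂ)
      (hφΩ.restrict φ Ω Ω) T₁)
    (hT₂ : IsWeightedComposition (fun z : Ω ↦ ψ₂ z • ContinuousLinearMap.id ℂ ℂ)
      (hφΩ.restrict φ Ω Ω) T₂) (f : HilbertTensor H₁ H₂) (z : Ω) (i : Fin (n + 1)) :
    ⟪jetVector H₁ d z i, HilbertTensor.map T₁ T₂ f⟫_ℂ =
      ∑ j : Fin (n + 1), (ψ₁ z • (jetMatrix n ψ₂ z * bellMatrix n φ z)) i j *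
        ⟪jetVector H₁ d (hφΩ.restrict φ Ω Ω z) j, f⟫_ℂ := by
  have hz := hΩ.mem_nhds z.2
  set g := zeroExtend (HilbertTensor.contract (H₂ := H₂)
    (RKHS.kerFun H₁ (hφΩ.restrict φ Ω Ω z) 1) f) with hg
  have hgc : ContDiffAt ℂ n g (φ z) := contDiffAt_zeroExtend hΩ hK₂ hH₂ _ (hφΩ z.2)
  -- Only the second variable is differentiated, so `ψ₁ z` is a constant factor. Equality near `z`
  -- is enough, which makes the extension by zero harmless.
  have hs : slice (⇑(HilbertTensor.map T₁ T₂ f) : Ω × Ω → ℂ) z =ᶠ[nhds (z : ℂ)]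
      ψ₁ z • (ψ₂ * (g ∘ φ)) := by
    filter_upwards [hz] with ζ hζ
    rw [slice_eq_zeroExtend, zeroExtend_of_mem _ hζ, HilbertTensor.contract_kerFun_apply,
      HilbertTensor.map_apply_of_isWeightedComposition hT₁ hT₂]
    simp only [Pi.smul_apply, Pi.mul_apply, Function.comp_apply, smul_eq_mul, mul_assoc]
    rw [hg, zeroExtend_of_mem _ (hφΩ hζ), HilbertTensor.contract_kerFun_apply]
    rfl
  have hψc : ContDiffAt ℂ n ψ₂ z := (hψ₂.analyticAt hz).contDiffAt
  have hφc : ContDiffAt ℂ n φ z := (hφ.analyticAt hz).contDiffAt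
  rw [inner_jetVector hd, hs.iteratedDeriv_eq,
    iteratedDeriv_const_smul_field,
    iteratedDeriv_mul_comp_eq_sum hψc hgc hφc, smul_eq_mul, Finset.mul_sum]
  refine Finset.sum_congr rfl fun j _ ↦ ?_
  rw [inner_jetVector hd, slice_eq_zeroExtend, Matrix.smul_apply, smul_eq_mul, mul_assoc]
  rfl

end Jets

/-! ### The compression as a weighted composition operator -/

theorem mainTheorem7 {Ω : Set ℂ} (hΩo : IsOpen Ω) (hΩc : IsConnected Ω)
    (hΩb : Bornology.IsBounded Ω)
    {K₁ K₂ : ℂ → ℂ → ℂ} (hK₁ : SesquiAnalyticOn Ω K₁) (hK₂ : SesquiAnalyticOn Ω K₂)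
    {H₁ H₂ : Type*}
    [NormedAddCommGroup H₁] [InnerProductSpace ℂ H₁] [CompleteSpace H₁] [RKHS ℂ H₁ Ω ℂ]
    [NormedAddCommGroup H₂] [InnerProductSpace ℂ H₂] [CompleteSpace H₂] [RKHS ℂ H₂ Ω ℂ]
    (hH₁ : RKHS.kernel H₁ = scalarKernel Ω K₁) (hH₂ : RKHS.kernel H₂ = scalarKernel Ω K₂)
    (hM₁ : ∃ M : H₁ →L[ℂ] H₁,
      IsWeightedComposition (fun z : Ω ↦ (z : ℂ) • ContinuousLinearMap.id ℂ ℂ) id M)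
    (hM₂ : ∃ M : H₂ →L[ℂ] H₂,
      IsWeightedComposition (fun z : Ω ↦ (z : ℂ) • ContinuousLinearMap.id ℂ ℂ) id M)
    (n : ℕ) {ψ₁ ψ₂ φ : ℂ → ℂ}
    (hψ₁ : DifferentiableOn ℂ ψ₁ Ω) (hψ₂ : DifferentiableOn ℂ ψ₂ Ω)
    (hφ : DifferentiableOn ℂ φ Ω) (hφΩ : Set.MapsTo φ Ω Ω)
    (T₁ : H₁ →L[ℂ] H₁) (T₂ : H₂ →L[ℂ] H₂)
    (hT₁ : IsWeightedComposition (fun z : Ω ↦ ψ₁ z • ContinuousLinearMap.id ℂ ℂ)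
      (hφΩ.restrict φ Ω Ω) T₁)
    (hT₂ : IsWeightedComposition (fun z : Ω ↦ ψ₂ z • ContinuousLinearMap.id ℂ ℂ)
      (hφΩ.restrict φ Ω Ω) T₂) :
    (matrixKernel Ω (jetKernel n K₁ K₂)).PosSemidef ∧
    ∀ (HJ : Type*) [NormedAddCommGroup HJ] [InnerProductSpace ℂ HJ] [CompleteSpace HJ]
      [RKHS ℂ HJ Ω (EuclideanSpace ℂ (Fin (n + 1)))],
      RKHS.kernel HJ = matrixKernel Ω (jetKernel n K₁ K₂) →
      ∃ T : HJ →L[ℂ] HJ,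
        IsWeightedComposition
          (fun z : Ω ↦ Matrix.toEuclideanCLM (𝕜 := ℂ)
            (ψ₁ z • (jetMatrix n ψ₂ z * bellMatrix n φ z)))
          (hφΩ.restrict φ Ω Ω) T ∧
        UnitarilyEquivalent (E := jetKerPerp H₁ H₂ n)
          (compression (jetKerPerp H₁ H₂ n) (HilbertTensor.map T₁ T₂)) T ∧
        ‖T‖ ≤ ‖T₁‖ * ‖T₂‖ := by
  choose d hd using exists_inner_eq_iteratedDeriv hΩo hK₂ hH₂
  let e : Ω → Fin (n + 1) → HilbertTensor H₁ H₂ := fun z i ↦ jetVector H₁ d z i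
  let S := jetKerPerp H₁ H₂ n
  have hS := eq_zero_of_mem_jetKerPerp (H₁ := H₁) hd n
  have he := jetVector_mem_jetKerPerp (H₁ := H₁) hd n
  have : CompleteSpace S := inferInstanceAs (CompleteSpace ((Submodule.span ℂ (jetKer H₁ H₂ n))ᗮ :))
  let _ := RKHS.ofVectors S e hS
  have hker : RKHS.kernel S = matrixKernel Ω (jetKernel n K₁ K₂) := by
    rw [RKHS.kernel_ofVectors S e hS he]
    simp only [e, inner_jetVector_jetVector hd hΩo hH₁ hH₂]
    rfl
  refine ⟨hker ▸ RKHS.posSemidef_kernel S, ?_⟩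
  intro HJ _ _ _ _ hHJ
  obtain ⟨U, hU⟩ := RKHS.exists_linearIsometryEquiv (hker.trans hHJ.symm)
  let C := compression S (HilbertTensor.map T₁ T₂)
  let T : HJ →L[ℂ] HJ := (U : S →L[ℂ] HJ) ∘L C ∘L (U.symm : HJ →L[ℂ] S)
  refine ⟨T, fun f z ↦ ?_, ⟨U, fun x ↦ ?_⟩, ?_⟩
  · obtain ⟨x, rfl⟩ := U.surjective f
    have hT : T (U x) = U (C x) := by simp [T]
    rw [hT, hU, hU]
    ext i
    have h1 : (C x z : EuclideanSpace ℂ (Fin (n + 1))) i =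
        ⟪e z i, HilbertTensor.map T₁ T₂ x⟫_ℂ := by
      rw [RKHS.ofVectors_apply]
      -- As `e z i` lies in `S`, pairing with it does not see the projection.
      exact S.inner_orthogonalProjectionOnto_eq_of_mem_left ⟨_, he z i⟩ _
    rw [h1, inner_jetVector_map hd n hΩo hK₂ hH₂ hψ₂ hφ hφΩ hT₁ hT₂]
    rfl
  · change U (C x) = T (U x)
    simp [T]
  · refine le_trans ?_ (HilbertTensor.norm_map_le T₁ T₂)
    refine ContinuousLinearMap.opNorm_le_bound _ (ContinuousLinearMap.opNorm_nonneg _) fun f ↦ ?_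
    have h1 : ‖T f‖ = ‖C (U.symm f)‖ := U.norm_map _
    rw [h1, ← U.symm.norm_map f]
    exact (S.norm_orthogonalProjectionOnto_apply_le _).trans
      ((HilbertTensor.map T₁ T₂).le_opNorm _)
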